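/- **Theorem 5.1.** Let $(\Omega,\mathcal F,(\mathcal F_t)_{t\ge 0},\mathbb P)$ be a filtered probability space, $T>0$, $\lambda>0$, $W$ an $m$-dimensional standard $(\mathcal F_t)$-Brownian motion and $N$ a one-dimensional $(\mathcal F_t)$-Poisson process of intensity $\lambda$ (both are adapted, and their increments after time $s$ are independent of $\mathcal F_s$). Put $\overline N_t=N_t-\lambda t$. Let $X_0$ be an $\mathcal F_0$-measurable $\mathbb R^d$-valued random variable with $\mathbb E\|X_0\|^p<\infty$ for all $p>0$. Let $u,v,h:\mathbb R^d\to\mathbb R^d$ and $g:\mathbb R^d\to\mathbb R^{d\times m}$ be such that $f:=u+v$, $g$ and $h$ are of class $C^1$ and, for some constants $C,K,c>0$ and all $x,y\in\mathbb R^d$, $$\|g(x)-g(y)\|\vee\|h(x)-h(y)\|\vee\|u(x)-u(y)\|\le C\|x-y\|,$$ $$\langle x-y,\,f(x)-f(y)\rangle\le C\|x-y\|^2,$$ $$\|v(x)-v(y)\|\le C\,(K+\|x\|^c+\|y\|^c)\,\|x-y\|,$$ where $\|\cdot\|$ is the Euclidean norm on vectors and the operator norm on matrices. For an integer $M\ge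 1$ put $\Delta t=T/M$, $t_n=n\Delta t$, $\Delta W_n=W_{t_{n+1}}-W_{t_n}$, $\Delta\overline N_n=\overline N_{t_{n+1}}-\overline N_{t_n}$, and define the semi-tamed Euler iterates, in which only the non-Lipschitz part $v$ of the drift is tamed, by $Y_0^M=X_0$ and $$Y_{n+1}^M=Y_n^M+u(Y_n^M)\Delta t+\lambda h(Y_n^M)\Delta t+\frac{\Delta t\,v(Y_n^M)}{1+\Delta t\|v(Y_n^M)\|}+g(Y_n^M)\Delta W_n+h(Y_n^M)\Delta\overline N_n,\qquad 0\le n<M.$$ Then for every real $p\in[1,\infty)$ $$\sup_{M\ge 1}\ \sup_{0\le n\le M}\ \mathbb E\big[\|Y_n^M\|^p\big]<\infty .$$ -/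

import Mathlib

open MeasureTheory ProbabilityTheory
open scoped NNReal ENNReal

noncomputable section

namespace SemiTamed

/-- `W` is an `m`-dimensional standard Brownian motion relative to the filtration `F`: it is adapted,
starts at `0`, has almost surely continuous paths, and for `s ≤ t` the increment `W t - W s` is
independent of `F s` and has law `N(0, (t - s) I)`, i.e. the law of `√(t - s) • Z` with `Z` a standard
Gaussian vector. -/
structure IsBrownianMotion {Ω : Type*} {mΩ : MeasurableSpace Ω} {m : ℕ}
    (W : ℝ≥0 → Ω → EuclideanSpace ℝ (Fin m)) (F : Filtration ℝ≥0 mΩ) (P : Measure Ω) : Prop where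
  adapted : ∀ t, Measurable[F t] (W t)
  zero : ∀ᵐ ω ∂P, W 0 ω = 0
  continuous_paths : ∀ᵐ ω ∂P, Continuous (fun t => W t ω)
  indep_increment : ∀ s t, s ≤ t →
    Indep (MeasurableSpace.comap (fun ω => W t ω - W s ω) inferInstance) (F s) P
  law_increment : ∀ s t, s ≤ t →
    HasLaw (fun ω => W t ω - W s ω)
      ((stdGaussian (EuclideanSpace ℝ (Fin m))).map (fun z => Real.sqrt ((t : ℝ) - s) • z)) P

/-- `N` is a (one-dimensional) Poisson process of intensity `lam` relative to the filtration `F`: it is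
an adapted `ℕ`-valued process starting at `0`, almost surely its paths are those of a counting
process (nondecreasing and right-continuous), and for `s ≤ t` the increment `N t - N s` is independent
of `F s` and is Poisson distributed with parameter `lam * (t - s)`. The increments are taken in `ℝ`. -/
structure IsPoissonProcess {Ω : Type*} {mΩ : MeasurableSpace Ω}
    (N : ℝ≥0 → Ω → ℕ) (lam : ℝ≥0) (F : Filtration ℝ≥0 mΩ) (P : Measure Ω) : Prop where
  adapted : ∀ t, Measurable[F t] (N t)
  zero : ∀ᵐ ω ∂P, N 0 ω = 0
  counting_paths : ∀ᵐ ω ∂P, Monotone (fun t => N t ω) ∧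
    ∀ t, ContinuousWithinAt (fun s => N s ω) (Set.Ici t) t
  indep_increment : ∀ s t, s ≤ t →
    Indep (MeasurableSpace.comap (fun ω => (N t ω : ℝ) - N s ω) inferInstance) (F s) P
  law_increment : ∀ s t, s ≤ t →
    HasLaw (fun ω => (N t ω : ℝ) - N s ω)
      ((poissonMeasure (lam * (t - s))).map (Nat.cast : ℕ → ℝ)) P

/-- The compensated process `N t - lam * t`. -/
def compensated {Ω : Type*} (N : ℝ≥0 → Ω → ℕ) (lam : ℝ≥0) (t : ℝ≥0) (ω : Ω) : ℝ :=
  (N t ω : ℝ) - lam * t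

/-- The `n`-th point `n * (T / M)` of the uniform grid of `[0, T]` with `M` steps. -/
def gridTime (T : ℝ≥0) (M n : ℕ) : ℝ≥0 := n * (T / M)

/-- The semi-tamed Euler iterates with `M` steps on `[0, T]`, with drift `u + v` (only `v` is tamed),
diffusion coefficient `g` and jump coefficient `h`, driven by the increments of `W` and of the
compensated process of `N`, and started at `X₀`. -/
def semiTamedEuler {Ω : Type*} {d m : ℕ}
    (u v : EuclideanSpace ℝ (Fin d) → EuclideanSpace ℝ (Fin d))
    (g : EuclideanSpace ℝ (Fin d) → EuclideanSpace ℝ (Fin m) →L[ℝ] EuclideanSpace ℝ (Fin d))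
    (h : EuclideanSpace ℝ (Fin d) → EuclideanSpace ℝ (Fin d))
    (W : ℝ≥0 → Ω → EuclideanSpace ℝ (Fin m)) (N : ℝ≥0 → Ω → ℕ) (lam : ℝ≥0)
    (X₀ : Ω → EuclideanSpace ℝ (Fin d)) (T : ℝ≥0) (M : ℕ) :
    ℕ → Ω → EuclideanSpace ℝ (Fin d)
  | 0, ω => X₀ ω
  | n + 1, ω =>
    let Δt : ℝ := (T : ℝ) / M
    let y := semiTamedEuler u v g h W N lam X₀ T M n ω
    y + Δt • u y + ((lam : ℝ) * Δt) • h y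
      + (Δt / (1 + Δt * ‖v y‖)) • v y
      + g y (W (gridTime T M (n + 1)) ω - W (gridTime T M n) ω)
      + (compensated N lam (gridTime T M (n + 1)) ω - compensated N lam (gridTime T M n) ω) • h y

end SemiTamed

end

namespace SemiTamed

section Deterministic

variable {E : Type*} [NormedAddCommGroup E] [InnerProductSpace ℝ E]

/-- A locally bounded one-sided Lipschitz vector field gains `‖v x‖` in its dissipativity bound. -/
theorem inner_add_norm_le_of_onesided {v : E → E} {C A : ℝ} (hC : 0 ≤ C) (hA : 0 ≤ A)
    (hv : ∀ x y, inner ℝ (x - y) (v x - v y) ≤ C * ‖x - y‖ ^ 2)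
    (hbd : ∀ y, ‖y‖ = 1 → ‖v y‖ ≤ A) (x : E) :
    inner ℝ x (v x) + ‖v x‖ ≤ (2 * C + 2 * A) * (1 + ‖x‖ ^ 2) := by
  by_cases h0 : v x = 0
  · simp only [h0, inner_zero_right, norm_zero, add_zero]; positivity
  have hn : ‖v x‖ ≠ 0 := norm_ne_zero_iff.mpr h0
  set y : E := -(‖v x‖⁻¹ • v x) with hy
  have hy1 : ‖y‖ = 1 := by
    rw [hy, norm_neg, norm_smul, norm_inv, norm_norm, inv_mul_cancel₀ hn]
  have hyv : inner ℝ y (v x) = -‖v x‖ := by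
    rw [hy, inner_neg_left, real_inner_smul_left, real_inner_self_eq_norm_sq]
    field_simp
  have h1 := hv x y
  have h2 : inner ℝ (x - y) (v x - v y) = inner ℝ x (v x) + ‖v x‖ - inner ℝ (x - y) (v y) := by
    rw [inner_sub_right, inner_sub_left x y (v x), hyv]; ring
  have h3 : inner ℝ (x - y) (v y) ≤ ‖x - y‖ * A :=
    (real_inner_le_norm _ _).trans (mul_le_mul_of_nonneg_left (hbd y hy1) (norm_nonneg _))
  have h4 : ‖x - y‖ ≤ ‖x‖ + 1 := by simpa [hy1] using norm_sub_le x y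
  have h5 : ‖x - y‖ ^ 2 ≤ 2 * (1 + ‖x‖ ^ 2) := by
    nlinarith [norm_nonneg (x - y), norm_nonneg x, sq_nonneg (‖x‖ - 1)]
  have h6 : ‖x - y‖ ≤ 2 * (1 + ‖x‖ ^ 2) := by nlinarith [sq_nonneg (‖x‖ - 1)]
  nlinarith [mul_le_mul_of_nonneg_left h5 hC, mul_le_mul_of_nonneg_right h6 hA]

/-- The tamed Euler step of such a field increases `1 + ‖x‖ ^ 2` by a factor `1 + O(δ)` only. -/
theorem norm_tamed_sq_le {x v : E} {D δ : ℝ} (hD : 0 ≤ D) (hδ : 0 ≤ δ)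
    (h : inner ℝ x v + ‖v‖ ≤ D * (1 + ‖x‖ ^ 2)) :
    1 + ‖x + (δ / (1 + δ * ‖v‖)) • v‖ ^ 2 ≤ (1 + 2 * D * δ) * (1 + ‖x‖ ^ 2) := by
  have hpos : 0 < 1 + δ * ‖v‖ := by positivity
  set τ := δ / (1 + δ * ‖v‖) with hτ
  have hτ0 : 0 ≤ τ := by positivity
  have hτδ : τ ≤ δ := div_le_self hδ (by nlinarith [mul_nonneg hδ (norm_nonneg v)])
  have hτ1 : τ * ‖v‖ ≤ 1 := by
    rw [hτ, div_mul_eq_mul_div, div_le_one hpos]; linarith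
  rw [norm_add_sq_real, real_inner_smul_right, norm_smul, Real.norm_of_nonneg hτ0]
  have h1 := mul_le_mul_of_nonneg_left h hτ0
  have h2 := mul_le_mul_of_nonneg_right hτδ (by positivity : 0 ≤ D * (1 + ‖x‖ ^ 2))
  have h3 : (τ * ‖v‖) ^ 2 ≤ τ * ‖v‖ := by nlinarith [mul_nonneg hτ0 (norm_nonneg v)]
  nlinarith [mul_nonneg hτ0 (norm_nonneg v)]

theorem exists_add_pow_le (q : ℕ) {R : ℝ} (hR : 0 ≤ R) :
    ∃ c : ℝ, 0 ≤ c ∧ ∀ a b : ℝ, 0 ≤ a → a ≤ R → 0 ≤ a + b →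
      (a + b) ^ q ≤ a ^ q + q * a ^ (q - 1) * b + c * (b ^ 2 * (1 + |b|) ^ q) := by
  induction q with
  | zero => exact ⟨0, le_rfl, fun a b _ _ _ => by simp⟩
  | succ q ih =>
    obtain ⟨c, hc, ih⟩ := ih
    refine ⟨q * R ^ (q - 1) + c * (R + 1), by positivity, fun a b ha haR hab => ?_⟩
    have h1 := mul_le_mul_of_nonneg_left (ih a b ha haR hab) hab
    have h2 : (q : ℝ) * a ^ (q - 1) * a = q * a ^ q := by
      cases q with
      | zero => simp
      | succ q => simp [pow_succ, mul_assoc]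
    have hb1 : 1 ≤ 1 + |b| := by linarith [abs_nonneg b]
    have h3 : (a + b) * (1 + |b|) ^ q ≤ (R + 1) * (1 + |b|) ^ (q + 1) := by
      rw [pow_succ', ← mul_assoc]
      refine mul_le_mul_of_nonneg_right ?_ (by positivity)
      nlinarith [le_abs_self b, abs_nonneg b, mul_nonneg hR (abs_nonneg b)]
    have h4 : a ^ (q - 1) ≤ R ^ (q - 1) * (1 + |b|) ^ (q + 1) :=
      (pow_le_pow_left₀ ha haR _).trans (le_mul_of_one_le_right (by positivity) (one_le_pow₀ hb1))
    have h5 := mul_le_mul_of_nonneg_left h3 (mul_nonneg hc (sq_nonneg b))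
    have h6 := mul_le_mul_of_nonneg_left h4 (mul_nonneg (Nat.cast_nonneg (α := ℝ) q) (sq_nonneg b))
    calc (a + b) ^ (q + 1) = (a + b) * (a + b) ^ q := by ring
      _ ≤ _ := h1
      _ = a ^ (q + 1) + a ^ q * b + (q * a ^ (q - 1) * a) * b + q * b ^ 2 * a ^ (q - 1)
          + c * b ^ 2 * ((a + b) * (1 + |b|) ^ q) := by ring
      _ ≤ a ^ (q + 1) + a ^ q * b + (q * a ^ (q - 1) * a) * b
          + q * b ^ 2 * (R ^ (q - 1) * (1 + |b|) ^ (q + 1))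
          + c * b ^ 2 * ((R + 1) * (1 + |b|) ^ (q + 1)) := by linarith
      _ = _ := by rw [h2, Nat.add_sub_cancel]; push_cast; ring

theorem sq_mul_one_add_abs_pow_le (q : ℕ) {b c η : ℝ} (hc : 0 ≤ c) (hη : 0 ≤ η)
    (hb : |b| ≤ c * (η + η ^ 2)) :
    b ^ 2 * (1 + |b|) ^ q ≤ 4 * c ^ 2 * (1 + 2 * c) ^ q * (η ^ 2 + η ^ (2 * q + 4)) := by
  have key : ∀ t : ℝ, 0 ≤ t → |b| ≤ c * (2 * t) → ∀ e : ℝ, 1 + |b| ≤ (1 + 2 * c) * e →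
      b ^ 2 * (1 + |b|) ^ q ≤ 4 * c ^ 2 * (1 + 2 * c) ^ q * (t ^ 2 * e ^ q) := by
    intro t ht hbt e he
    calc b ^ 2 * (1 + |b|) ^ q = |b| ^ 2 * (1 + |b|) ^ q := by rw [sq_abs]
      _ ≤ (c * (2 * t)) ^ 2 * ((1 + 2 * c) * e) ^ q := by gcongr
      _ = _ := by rw [mul_pow (1 + 2 * c)]; ring
  have hpos : 0 ≤ 4 * c ^ 2 * (1 + 2 * c) ^ q := by positivity
  rcases le_total η 1 with h | h
  · have hb' : |b| ≤ c * (2 * η) := hb.trans (by gcongr; nlinarith)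
    refine (key η hη hb' 1 ?_).trans (mul_le_mul_of_nonneg_left ?_ hpos)
    · nlinarith
    · simp; positivity
  · have hb' : |b| ≤ c * (2 * η ^ 2) := hb.trans (by gcongr; nlinarith)
    refine (key (η ^ 2) (by positivity) hb' (η ^ 2) ?_).trans (mul_le_mul_of_nonneg_left ?_ hpos)
    · nlinarith
    · have : (η ^ 2) ^ 2 * (η ^ 2) ^ q = η ^ (2 * q + 4) := by ring
      rw [this]; nlinarith

theorem exists_one_add_norm_sq_pow_le (q : ℕ) {R B : ℝ} (hR : 1 ≤ R) (hB : 0 ≤ B) :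
    ∃ c : ℝ, 0 ≤ c ∧ ∀ (z a w h : E) (s δ r k : ℝ), 1 ≤ s → 0 ≤ δ → 0 ≤ r → 0 ≤ k →
      1 + ‖z‖ ^ 2 ≤ R * s ^ 2 → ‖a‖ ≤ B * s → ‖h‖ ≤ B * s → ‖w‖ ≤ B * s * r →
      (1 + ‖z + δ • a + w + k • h‖ ^ 2) ^ q ≤ (1 + ‖z‖ ^ 2) ^ q
        + 2 * q * (1 + ‖z‖ ^ 2) ^ (q - 1) * inner ℝ z w
        + c * (s ^ 2) ^ q * (δ + k + (δ + r + k) ^ 2 + (δ + r + k) ^ (2 * q + 4)) := by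
  obtain ⟨c₀, hc₀, taylor⟩ := exists_add_pow_le q (zero_le_one.trans hR)
  set c₁ : ℝ := 2 * R * B + B ^ 2 with hc₁
  have hR0 : 0 ≤ R := by linarith
  have hc₁0 : 0 ≤ c₁ := by positivity
  set c₂ : ℝ := q * R ^ (q - 1) * c₁ with hc₂
  set c₃ : ℝ := c₀ * (4 * c₁ ^ 2 * (1 + 2 * c₁) ^ q) with hc₃
  have hc₂0 : 0 ≤ c₂ := by positivity
  have hc₃0 : 0 ≤ c₃ := by positivity
  refine ⟨c₂ + c₃, by positivity, fun z a w h s δ r k hs hδ hr hk hz ha hh hw => ?_⟩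
  set η : ℝ := δ + r + k with hη
  have hη0 : 0 ≤ η := by positivity
  have hs0 : 0 < s := by linarith
  have hs2 : 0 < s ^ 2 := by positivity
  set ξ : E := δ • a + w + k • h with hξ
  have hy : z + δ • a + w + k • h = z + ξ := by rw [hξ]; abel
  have hδa : ‖δ • a‖ ≤ δ * (B * s) := by
    rw [norm_smul, Real.norm_of_nonneg hδ]; gcongr
  have hkh : ‖k • h‖ ≤ k * (B * s) := by
    rw [norm_smul, Real.norm_of_nonneg hk]; gcongr
  have hξn : ‖ξ‖ ≤ B * s * η := by
    have := norm_add₃_le (a := δ • a) (b := w) (c := k • h)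
    rw [hη]; linarith
  have hzn : ‖z‖ ≤ R * s := by
    refine (sq_le_sq₀ (norm_nonneg _) (by positivity)).mp ?_
    have : R * s ^ 2 ≤ R * (R * s ^ 2) := by
      refine mul_le_mul_of_nonneg_left ?_ hR0
      exact le_mul_of_one_le_left (by positivity) hR
    linarith [mul_pow R s 2]
  have hzξ : |inner ℝ z ξ| ≤ R * s * (B * s * η) :=
    (abs_real_inner_le_norm _ _).trans (mul_le_mul hzn hξn (norm_nonneg _) (by positivity))
  have hξ2 : ‖ξ‖ ^ 2 ≤ (B * s * η) ^ 2 := pow_le_pow_left₀ (norm_nonneg _) hξn 2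
  set A : ℝ := (1 + ‖z‖ ^ 2) / s ^ 2 with hA
  set b : ℝ := (2 * inner ℝ z ξ + ‖ξ‖ ^ 2) / s ^ 2 with hb
  have hA0 : 0 ≤ A := by positivity
  have hAR : A ≤ R := by rw [hA, div_le_iff₀ hs2]; exact hz
  have hAb : A + b = (1 + ‖z + ξ‖ ^ 2) / s ^ 2 := by
    rw [hA, hb, norm_add_sq_real z ξ]; ring
  have hbabs : |b| ≤ c₁ * (η + η ^ 2) := by
    rw [hb, abs_div, abs_of_pos hs2, div_le_iff₀ hs2]
    have h1 : |2 * inner ℝ z ξ + ‖ξ‖ ^ 2| ≤ 2 * |inner ℝ z ξ| + ‖ξ‖ ^ 2 := by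
      refine (abs_add_le _ _).trans ?_
      rw [abs_mul, abs_two, abs_of_nonneg (sq_nonneg ‖ξ‖)]
    have h2 : 0 ≤ (2 * R * B * η ^ 2 + B ^ 2 * η) * s ^ 2 := by positivity
    rw [hc₁]; linarith
  have hzδ : inner ℝ z (δ • a) ≤ R * s * (δ * (B * s)) :=
    (real_inner_le_norm _ _).trans (mul_le_mul hzn hδa (norm_nonneg _) (by positivity))
  have hzk : inner ℝ z (k • h) ≤ R * s * (k * (B * s)) :=
    (real_inner_le_norm _ _).trans (mul_le_mul hzn hkh (norm_nonneg _) (by positivity))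
  have hblin : b ≤ 2 * inner ℝ z w / s ^ 2 + c₁ * (δ + k + η ^ 2) := by
    have hin : inner ℝ z ξ = inner ℝ z (δ • a) + inner ℝ z w + inner ℝ z (k • h) := by
      rw [hξ, inner_add_right, inner_add_right]
    rw [hb, div_le_iff₀ hs2, add_mul, div_mul_cancel₀ _ hs2.ne', hin]
    have h2 : 0 ≤ (2 * R * B * η ^ 2 + B ^ 2 * (δ + k)) * s ^ 2 := by positivity
    rw [hc₁]; linarith
  have hq : (q : ℝ) * A ^ (q - 1) ≤ q * R ^ (q - 1) := by gcongr
  have hmain : (A + b) ^ q ≤ A ^ q + q * A ^ (q - 1) * (2 * inner ℝ z w / s ^ 2)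
      + (c₂ + c₃) * (δ + k + η ^ 2 + η ^ (2 * q + 4)) := by
    have h1 := taylor A b hA0 hAR (by rw [hAb]; positivity)
    have h2 := mul_le_mul_of_nonneg_left hblin (by positivity : 0 ≤ (q : ℝ) * A ^ (q - 1))
    have h3 := mul_le_mul_of_nonneg_right hq
      (by positivity : 0 ≤ c₁ * (δ + k + η ^ 2))
    have h4 := mul_le_mul_of_nonneg_left (sq_mul_one_add_abs_pow_le q hc₁0 hη0 hbabs) hc₀
    have h5 : 0 ≤ c₂ * η ^ (2 * q + 4) := by positivity
    have h6 : 0 ≤ c₃ * (δ + k) := by positivity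
    rw [hc₂] at h5 ⊢
    rw [hc₃] at h6 ⊢
    linarith
  have hs2q : 0 ≤ (s ^ 2) ^ q := by positivity
  have hfin := mul_le_mul_of_nonneg_left hmain hs2q
  have e1 : (s ^ 2) ^ q * (A + b) ^ q = (1 + ‖z + ξ‖ ^ 2) ^ q := by
    rw [hAb, ← mul_pow, mul_div_cancel₀ _ hs2.ne']
  have e2 : (s ^ 2) ^ q * A ^ q = (1 + ‖z‖ ^ 2) ^ q := by
    rw [hA, ← mul_pow, mul_div_cancel₀ _ hs2.ne']
  have e3 : (s ^ 2) ^ q * (q * A ^ (q - 1) * (2 * inner ℝ z w / s ^ 2))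
      = 2 * q * (1 + ‖z‖ ^ 2) ^ (q - 1) * inner ℝ z w := by
    cases q with
    | zero => simp
    | succ q =>
      simp only [Nat.add_sub_cancel, hA, div_pow]
      have := pow_pos hs2 q
      rw [pow_succ (s ^ 2)]
      field_simp
  rw [hy]
  rw [mul_add, mul_add, e1, e2, e3] at hfin
  linarith

theorem add_add_pow_le (j : ℕ) {a b c : ℝ} (ha : 0 ≤ a) (hb : 0 ≤ b) (hc : 0 ≤ c) :
    (a + b + c) ^ j ≤ 3 ^ j * (a ^ j + b ^ j + c ^ j) := by
  have key : ∀ x : ℝ, 0 ≤ x → a ≤ x → b ≤ x → c ≤ x → (a + b + c) ^ j ≤ 3 ^ j * x ^ j := by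
    intro x _ h1 h2 h3
    rw [← mul_pow]
    exact pow_le_pow_left₀ (by positivity) (by linarith) _
  have h3 : (0 : ℝ) ≤ 3 ^ j := by positivity
  have pa := pow_nonneg ha j
  have pb := pow_nonneg hb j
  have pc := pow_nonneg hc j
  rcases le_total a b with hab | hab <;> rcases le_total b c with hbc | hbc <;>
    rcases le_total a c with hac | hac
  all_goals first
    | exact (key c hc hac hbc le_rfl).trans (mul_le_mul_of_nonneg_left (by linarith) h3)
    | exact (key b hb hab le_rfl hbc).trans (mul_le_mul_of_nonneg_left (by linarith) h3)
    | exact (key a ha le_rfl hab hac).trans (mul_le_mul_of_nonneg_left (by linarith) h3)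
    | exact (key c hc (hab.trans hbc) hbc le_rfl).trans (mul_le_mul_of_nonneg_left (by linarith) h3)
    | exact (key a ha le_rfl hab (hbc.trans hab)).trans (mul_le_mul_of_nonneg_left (by linarith) h3)

end Deterministic

section Increments

theorem integrable_comp_of_hasLaw {Ω 𝓧 E : Type*} {mΩ : MeasurableSpace Ω} {m𝓧 : MeasurableSpace 𝓧}
    [NormedAddCommGroup E] {P : Measure Ω} {μ : Measure 𝓧} {X : Ω → 𝓧} {f : 𝓧 → E}
    (hX : HasLaw X μ P) (hf : Integrable f μ) : Integrable (fun ω => f (X ω)) P := by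
  rw [← hX.map_eq] at hf
  exact hf.comp_aemeasurable hX.aemeasurable

theorem exists_poisson_moment_le (R : ℝ≥0) (j : ℕ) :
    ∃ C : ℝ, 0 ≤ C ∧ ∀ r : ℝ≥0, r ≤ R →
      Integrable (fun n : ℕ => (n : ℝ) ^ (j + 1)) (poissonMeasure r) ∧
      ∫ n, (n : ℝ) ^ (j + 1) ∂poissonMeasure r ≤ C * r := by
  let b : ℕ → ℝ := fun n => (j.factorial * Real.exp 1) * ((R * Real.exp 1) ^ n / n.factorial)
  have hb : Summable b := (Real.summable_pow_div_factorial _).mul_left _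
  have hb0 : ∀ n, 0 ≤ b n := fun n => by positivity
  refine ⟨∑' n, b n, tsum_nonneg hb0, fun r hr => ?_⟩
  set f : ℕ → ℝ := fun n => Real.exp (-r) * r ^ n / n.factorial * (n : ℝ) ^ (j + 1) with hf
  have hle : ∀ n, f (n + 1) ≤ r * b n := by
    intro n
    have h1 : ((n : ℝ) + 1) ^ j ≤ j.factorial * (Real.exp 1 * Real.exp 1 ^ n) := by
      have := Real.pow_div_factorial_le_exp ((n : ℝ) + 1) (by positivity) j
      rw [div_le_iff₀ (by positivity)] at this
      rw [← Real.exp_nat_mul, ← Real.exp_add]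
      calc _ ≤ _ := this
        _ = _ := by rw [mul_comm]; congr 2; ring
    have h2 : Real.exp (-(r : ℝ)) ≤ 1 := Real.exp_le_one_iff.mpr (by simp)
    have h3 : (r : ℝ) ^ n ≤ (R : ℝ) ^ n := by gcongr
    have e : f (n + 1) = r * (Real.exp (-r) * r ^ n / n.factorial * ((n : ℝ) + 1) ^ j) := by
      simp only [hf, Nat.factorial_succ]
      push_cast
      field_simp
      ring
    rw [e]
    gcongr
    calc Real.exp (-r) * r ^ n / n.factorial * ((n : ℝ) + 1) ^ j
        ≤ 1 * R ^ n / n.factorial * (j.factorial * (Real.exp 1 * Real.exp 1 ^ n)) := by gcongr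
      _ = b n := by simp only [b]; rw [mul_pow]; ring
  have hf0 : ∀ n, 0 ≤ f n := fun n => by positivity
  have hs1 : Summable fun n => f (n + 1) :=
    Summable.of_nonneg_of_le (fun n => hf0 _) hle (hb.mul_left _)
  have hs : Summable f := (summable_nat_add_iff 1).mp hs1
  have hint : Integrable (fun n : ℕ => (n : ℝ) ^ (j + 1)) (poissonMeasure r) := by
    rw [integrable_poissonMeasure_iff]
    refine hs.congr fun n => ?_
    rw [Real.norm_of_nonneg (by positivity)]
  refine ⟨hint, ?_⟩
  have hsum := (hasSum_integral_poissonMeasure hint).tsum_eq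
  rw [← hsum]
  simp only [smul_eq_mul]
  change ∑' n, f n ≤ _
  rw [hs.tsum_eq_zero_add]
  have hz : f 0 = 0 := by simp [hf]
  rw [hz, zero_add, mul_comm, ← tsum_mul_left]
  exact hs1.tsum_le_tsum hle (hb.mul_left _)

variable {Ω : Type*} {mΩ : MeasurableSpace Ω} {P : Measure Ω} {F : Filtration ℝ≥0 mΩ}

theorem IsPoissonProcess.exists_moment_le {N : ℝ≥0 → Ω → ℕ} {lam : ℝ≥0}
    (hN : IsPoissonProcess N lam F P) (T : ℝ≥0) {j : ℕ} (hj : 1 ≤ j) :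
    ∃ C : ℝ, 0 ≤ C ∧ ∀ s t : ℝ≥0, s ≤ t → t - s ≤ T →
      Integrable (fun ω => ((N t ω : ℝ) - N s ω) ^ j) P ∧
      ∫ ω, ((N t ω : ℝ) - N s ω) ^ j ∂P ≤ C * ((t - s : ℝ≥0) : ℝ) := by
  obtain ⟨i, rfl⟩ : ∃ i, j = i + 1 := ⟨j - 1, by omega⟩
  obtain ⟨C, hC, h⟩ := exists_poisson_moment_le (lam * T) i
  refine ⟨C * lam, by positivity, fun s t hst hT => ?_⟩
  obtain ⟨h1, h2⟩ := h (lam * (t - s)) (mul_le_mul_right hT lam)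
  have hl := hN.law_increment s t hst
  have hcast : Measurable (Nat.cast : ℕ → ℝ) := Measurable.of_discrete
  have hmeas : StronglyMeasurable (fun x : ℝ => x ^ (i + 1)) := (continuous_pow _).stronglyMeasurable
  have hi : Integrable (fun x : ℝ => x ^ (i + 1))
      ((poissonMeasure (lam * (t - s))).map (Nat.cast : ℕ → ℝ)) :=
    (integrable_map_measure hmeas.aestronglyMeasurable hcast.aemeasurable).mpr h1
  refine ⟨integrable_comp_of_hasLaw hl hi, ?_⟩
  have h3 := hl.integral_comp hi.aestronglyMeasurable
  rw [integral_map hcast.aemeasurable hmeas.aestronglyMeasurable] at h3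
  refine h3.le.trans (h2.trans_eq ?_)
  push_cast; ring

variable {m : ℕ}

theorem IsBrownianMotion.integrable_increment {W : ℝ≥0 → Ω → EuclideanSpace ℝ (Fin m)}
    (hW : IsBrownianMotion W F P) {s t : ℝ≥0} (hst : s ≤ t) :
    Integrable (fun ω => W t ω - W s ω) P := by
  refine integrable_comp_of_hasLaw (f := id) (hW.law_increment s t hst) ?_
  refine (integrable_map_measure aestronglyMeasurable_id (by fun_prop)).mpr ?_
  have h : Integrable id (stdGaussian (EuclideanSpace ℝ (Fin m))) :=
    (IsGaussian.memLp_id _ 1 (by norm_num)).integrable le_rfl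
  exact h.smul (Real.sqrt ((t : ℝ) - s))

theorem IsBrownianMotion.integral_increment {W : ℝ≥0 → Ω → EuclideanSpace ℝ (Fin m)}
    (hW : IsBrownianMotion W F P) {s t : ℝ≥0} (hst : s ≤ t) :
    ∫ ω, (W t ω - W s ω) ∂P = 0 := by
  rw [(hW.law_increment s t hst).integral_eq, integral_map (by fun_prop) (by fun_prop),
    integral_smul, integral_id_stdGaussian, smul_zero]

theorem IsBrownianMotion.exists_moment_le {W : ℝ≥0 → Ω → EuclideanSpace ℝ (Fin m)}
    (hW : IsBrownianMotion W F P) (T : ℝ≥0) {j : ℕ} (hj : 1 ≤ j) :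
    ∃ C : ℝ, 0 ≤ C ∧ ∀ s t : ℝ≥0, s ≤ t → t - s ≤ T →
      Integrable (fun ω => ‖W t ω - W s ω‖ ^ (2 * j)) P ∧
      ∫ ω, ‖W t ω - W s ω‖ ^ (2 * j) ∂P ≤ C * ((t - s : ℝ≥0) : ℝ) := by
  set γ := stdGaussian (EuclideanSpace ℝ (Fin m))
  have hγ : Integrable (fun z => ‖z‖ ^ (2 * j)) γ :=
    (IsGaussian.memLp_id γ ((2 * j : ℕ) : ℝ≥0∞) (ENNReal.natCast_ne_top _)).integrable_norm_pow
      (by omega)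
  refine ⟨T ^ (j - 1) * ∫ z, ‖z‖ ^ (2 * j) ∂γ, by positivity, fun s t hst hT => ?_⟩
  have hl := hW.law_increment s t hst
  set δ : ℝ := ((t - s : ℝ≥0) : ℝ) with hδ
  have hδ0 : 0 ≤ δ := NNReal.coe_nonneg _
  have hδs : (t : ℝ) - s = δ := (NNReal.coe_sub hst).symm
  rw [hδs] at hl
  have e : ∀ z : EuclideanSpace ℝ (Fin m), ‖Real.sqrt δ • z‖ ^ (2 * j) = δ ^ j * ‖z‖ ^ (2 * j) := by
    intro z
    rw [norm_smul, mul_pow, Real.norm_of_nonneg (Real.sqrt_nonneg _), pow_mul, Real.sq_sqrt hδ0]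
  have hsm : AEMeasurable (fun z : EuclideanSpace ℝ (Fin m) => Real.sqrt δ • z) γ := by fun_prop
  have hmeas : StronglyMeasurable (fun z : EuclideanSpace ℝ (Fin m) => ‖z‖ ^ (2 * j)) :=
    (continuous_norm.pow _).stronglyMeasurable
  have hi : Integrable (fun z => ‖z‖ ^ (2 * j)) (γ.map fun z => Real.sqrt δ • z) := by
    refine (integrable_map_measure hmeas.aestronglyMeasurable hsm).mpr ?_
    refine (hγ.const_mul (δ ^ j)).congr (.of_forall fun z => (e z).symm)
  refine ⟨integrable_comp_of_hasLaw (f := fun z => ‖z‖ ^ (2 * j)) hl hi, ?_⟩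
  have h3 := hl.integral_comp hi.aestronglyMeasurable
  rw [integral_map hsm hmeas.aestronglyMeasurable] at h3
  simp_rw [e] at h3
  rw [integral_const_mul] at h3
  refine h3.le.trans ?_
  have hpow : δ ^ j ≤ T ^ (j - 1) * δ := by
    obtain ⟨i, rfl⟩ : ∃ i, j = i + 1 := ⟨j - 1, by omega⟩
    rw [pow_succ, Nat.add_sub_cancel]
    have : δ ≤ T := by exact_mod_cast hT
    gcongr
  have : 0 ≤ ∫ z, ‖z‖ ^ (2 * j) ∂γ := by positivity
  nlinarith

theorem indepFun_of_indep_comap {α β : Type*} [MeasurableSpace α] [MeasurableSpace β]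
    {m' : MeasurableSpace Ω} {X : Ω → α} {Z : Ω → β} (hX : Measurable[m'] X)
    (h : Indep (MeasurableSpace.comap Z inferInstance) m' P) : IndepFun X Z P :=
  (IndepFun_iff_Indep _ _ _).mpr (indep_of_indep_of_le_left h.symm hX.comap_le)

end Increments

section Step

variable {Ω : Type*} {mΩ : MeasurableSpace Ω} {P : Measure Ω} {F : Filtration ℝ≥0 mΩ} {d m : ℕ}

theorem integral_inner_increment {α : Type*} [MeasurableSpace α] {X : Ω → α}
    {H : α → EuclideanSpace ℝ (Fin m)} {D : Ω → EuclideanSpace ℝ (Fin m)}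
    (hXD : IndepFun X D P) (hH : Measurable H) (hHi : Integrable (fun ω => H (X ω)) P)
    (hD : Integrable D P) (hD0 : ∫ ω, D ω ∂P = 0) :
    Integrable (fun ω => inner ℝ (H (X ω)) (D ω)) P ∧ ∫ ω, inner ℝ (H (X ω)) (D ω) ∂P = 0 := by
  have hind : IndepFun (fun ω => H (X ω)) D P := hXD.comp hH measurable_id
  refine ⟨hind.integrable_bilin hHi hD (innerSL ℝ), ?_⟩
  refine (hind.integral_bilin hHi hD (innerSL ℝ)).trans ?_
  rw [hD0, map_zero]

theorem integrable_mul_and_integral_le {α β : Type*} [MeasurableSpace α] [MeasurableSpace β]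
    {X : Ω → α} {D : Ω → β} {f : α → ℝ} {φ : β → ℝ} {b : ℝ} (hXD : IndepFun X D P)
    (hf : Measurable f) (hφ : Measurable φ) (hf0 : ∀ x, 0 ≤ f x)
    (hfi : Integrable (fun ω => f (X ω)) P) (hφi : Integrable (fun ω => φ (D ω)) P)
    (hb : ∫ ω, φ (D ω) ∂P ≤ b) :
    Integrable (fun ω => f (X ω) * φ (D ω)) P ∧
      ∫ ω, f (X ω) * φ (D ω) ∂P ≤ b * ∫ ω, f (X ω) ∂P := by
  have hind : IndepFun (fun ω => f (X ω)) (fun ω => φ (D ω)) P := hXD.comp hf hφ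
  refine ⟨hind.integrable_mul hfi hφi, ?_⟩
  have h := hind.integral_mul_eq_mul_integral hfi.aestronglyMeasurable hφi.aestronglyMeasurable
  simp only [Pi.mul_apply] at h
  rw [h, mul_comm]
  exact mul_le_mul_of_nonneg_right hb (integral_nonneg fun ω => hf0 _)

/- The proof assembles many moment bounds in one context. -/
set_option maxHeartbeats 1000000 in
/-- One step of the semi-tamed Euler scheme multiplies the moment of order `2 * q` by at most
`exp (c * δ)`. -/
theorem exists_integral_step_le [IsProbabilityMeasure P]
    {u v h : EuclideanSpace ℝ (Fin d) → EuclideanSpace ℝ (Fin d)}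
    {g : EuclideanSpace ℝ (Fin d) → EuclideanSpace ℝ (Fin m) →L[ℝ] EuclideanSpace ℝ (Fin d)}
    {W : ℝ≥0 → Ω → EuclideanSpace ℝ (Fin m)} (hW : IsBrownianMotion W F P)
    {N : ℝ≥0 → Ω → ℕ} {lam : ℝ≥0} (hN : IsPoissonProcess N lam F P)
    (hv : Continuous v) (hg : Continuous g) {B D : ℝ} (hB : 0 ≤ B) (hD : 0 ≤ D)
    (hub : ∀ x, ‖u x‖ ≤ B * √(1 + ‖x‖ ^ 2)) (hhb : ∀ x, ‖h x‖ ≤ B * √(1 + ‖x‖ ^ 2))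
    (hgb : ∀ x, ‖g x‖ ≤ B * √(1 + ‖x‖ ^ 2))
    (hdis : ∀ x, inner ℝ x (v x) + ‖v x‖ ≤ D * (1 + ‖x‖ ^ 2)) (T : ℝ≥0) {q : ℕ} (hq : 1 ≤ q) :
    ∃ c : ℝ, 0 ≤ c ∧ ∀ (s t δ : ℝ≥0) (X : Ω → EuclideanSpace ℝ (Fin d)), s ≤ t → t - s = δ →
      δ ≤ T → Measurable[F s] X → Integrable (fun ω => (1 + ‖X ω‖ ^ 2) ^ q) P →
      ∀ X' : Ω → EuclideanSpace ℝ (Fin d), Measurable X' →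
      (∀ ω, X' ω = X ω + (δ : ℝ) • u (X ω) + ((lam : ℝ) * δ) • h (X ω)
        + ((δ : ℝ) / (1 + δ * ‖v (X ω)‖)) • v (X ω) + g (X ω) (W t ω - W s ω)
        + (compensated N lam t ω - compensated N lam s ω) • h (X ω)) →
      Integrable (fun ω => (1 + ‖X' ω‖ ^ 2) ^ q) P ∧
        ∫ ω, (1 + ‖X' ω‖ ^ 2) ^ q ∂P ≤ Real.exp (c * δ) * ∫ ω, (1 + ‖X ω‖ ^ 2) ^ q ∂P := by
  set R : ℝ := 1 + 2 * D * T with hR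
  have hR1 : 1 ≤ R := by rw [hR]; have : 0 ≤ 2 * D * T := by positivity
                         linarith
  obtain ⟨c₀, hc₀, hpt⟩ :=
    exists_one_add_norm_sq_pow_le (E := EuclideanSpace ℝ (Fin d)) q hR1 hB
  obtain ⟨w₁, hw₁0, hw₁⟩ := hW.exists_moment_le T le_rfl
  obtain ⟨w₂, hw₂0, hw₂⟩ := hW.exists_moment_le T (j := q + 2) (by omega)
  obtain ⟨n₀, hn₀0, hn₀⟩ := hN.exists_moment_le T le_rfl
  obtain ⟨n₁, hn₁0, hn₁⟩ := hN.exists_moment_le T (j := 2) (by omega)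
  obtain ⟨n₂, hn₂0, hn₂⟩ := hN.exists_moment_le T (j := 2 * q + 4) (by omega)
  set κ : ℝ := 3 ^ (2 * q + 4) with hκ
  have hκ0 : 0 ≤ κ := by positivity
  set e₀ : ℝ := 1 + 9 * T + κ * T ^ (2 * q + 3) with he₀
  set e₁ : ℝ := 9 * w₁ + κ * w₂ with he₁
  set e₂ : ℝ := n₀ + 9 * n₁ + κ * n₂ with he₂
  refine ⟨2 * D * q + c₀ * (e₀ + e₁ + e₂), by positivity, ?_⟩
  intro s t δ X hst hδ hδT hX hXi X' hX' hstep
  have hXm : Measurable X := hX.mono (F.le s) le_rfl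
  have hδT' : (δ : ℝ) ≤ T := by exact_mod_cast hδT
  have hδ0 : (0 : ℝ) ≤ δ := δ.coe_nonneg
  have hindW : IndepFun X (fun ω => W t ω - W s ω) P :=
    indepFun_of_indep_comap hX (hW.indep_increment s t hst)
  have hindN : IndepFun X (fun ω => (N t ω : ℝ) - N s ω) P :=
    indepFun_of_indep_comap hX (hN.indep_increment s t hst)
  have hts : t - s ≤ T := hδ.le.trans hδT
  let z : EuclideanSpace ℝ (Fin d) → EuclideanSpace ℝ (Fin d) :=
    fun x => x + ((δ : ℝ) / (1 + δ * ‖v x‖)) • v x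
  have hzc : Continuous z := by
    have hden : Continuous fun x => 1 + (δ : ℝ) * ‖v x‖ := by fun_prop
    exact continuous_id.add ((continuous_const.div hden fun x => by positivity).smul hv)
  have hzS : ∀ x, 1 + ‖z x‖ ^ 2 ≤ (1 + 2 * D * δ) * (1 + ‖x‖ ^ 2) := fun x =>
    norm_tamed_sq_le hD hδ0 (hdis x)
  have hS1 : ∀ x : EuclideanSpace ℝ (Fin d), 1 ≤ √(1 + ‖x‖ ^ 2) := fun x =>
    Real.one_le_sqrt.mpr (by have := sq_nonneg ‖x‖; linarith)
  have hSsq : ∀ x : EuclideanSpace ℝ (Fin d), √(1 + ‖x‖ ^ 2) ^ 2 = 1 + ‖x‖ ^ 2 := fun x =>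
    Real.sq_sqrt (by positivity)
  have hzR : ∀ x, 1 + ‖z x‖ ^ 2 ≤ R * (1 + ‖x‖ ^ 2) := fun x => (hzS x).trans (by
    rw [hR]; gcongr)
  let H : EuclideanSpace ℝ (Fin d) → EuclideanSpace ℝ (Fin m) := fun x =>
    (2 * q * (1 + ‖z x‖ ^ 2) ^ (q - 1)) • ContinuousLinearMap.adjoint (g x) (z x)
  have hHc : Continuous H := by
    have h1 : Continuous fun x => 2 * (q : ℝ) * (1 + ‖z x‖ ^ 2) ^ (q - 1) := by fun_prop
    exact h1.smul ((ContinuousLinearMap.adjoint.continuous.comp hg).clm_apply hzc)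
  have hHin : ∀ x y, inner ℝ (H x) y =
      2 * q * (1 + ‖z x‖ ^ 2) ^ (q - 1) * inner ℝ (z x) (g x y) := fun x y => by
    simp only [H]
    rw [real_inner_smul_left, ContinuousLinearMap.adjoint_inner_left]
  have hHb : ∀ x, ‖H x‖ ≤ 2 * q * R ^ q * B * (1 + ‖x‖ ^ 2) ^ q := by
    intro x
    have hzn : ‖z x‖ ≤ R * √(1 + ‖x‖ ^ 2) := by
      refine (sq_le_sq₀ (norm_nonneg _) (by positivity)).mp ?_
      rw [mul_pow, hSsq]
      have : R * (1 + ‖x‖ ^ 2) ≤ R ^ 2 * (1 + ‖x‖ ^ 2) := by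
        gcongr; nlinarith
      linarith [hzR x]
    have h1 : ‖ContinuousLinearMap.adjoint (g x) (z x)‖ ≤ B * R * (1 + ‖x‖ ^ 2) := by
      refine (ContinuousLinearMap.le_opNorm _ _).trans ?_
      rw [LinearIsometryEquiv.norm_map]
      calc ‖g x‖ * ‖z x‖ ≤ (B * √(1 + ‖x‖ ^ 2)) * (R * √(1 + ‖x‖ ^ 2)) := by
            gcongr; exact hgb x
        _ = B * R * (√(1 + ‖x‖ ^ 2)) ^ 2 := by ring
        _ = _ := by rw [hSsq]
    simp only [H]
    rw [norm_smul, Real.norm_of_nonneg (by positivity)]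
    calc _ ≤ (2 * q * (R * (1 + ‖x‖ ^ 2)) ^ (q - 1)) * (B * R * (1 + ‖x‖ ^ 2)) := by
          gcongr; exact hzR x
      _ = 2 * q * B * ((R * (1 + ‖x‖ ^ 2)) ^ (q - 1) * (R * (1 + ‖x‖ ^ 2))) := by ring
      _ = _ := by rw [pow_sub_one_mul (by omega), mul_pow]; ring
  have hHi : Integrable (fun ω => H (X ω)) P := by
    refine Integrable.mono' (hXi.const_mul (2 * q * R ^ q * B))
      (hHc.measurable.comp hXm).aestronglyMeasurable (.of_forall fun ω => hHb _)
  obtain ⟨hI₁, hI₁0⟩ := integral_inner_increment hindW hHc.measurable hHi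
    (hW.integrable_increment hst) (hW.integral_increment hst)
  let f : EuclideanSpace ℝ (Fin d) → ℝ := fun x => (1 + ‖x‖ ^ 2) ^ q
  have hfm : Measurable f := by fun_prop
  have hf0 : ∀ x, 0 ≤ f x := fun x => by positivity
  let φ : EuclideanSpace ℝ (Fin m) → ℝ := fun y => 9 * ‖y‖ ^ 2 + κ * ‖y‖ ^ (2 * (q + 2))
  let ψ : ℝ → ℝ := fun k => k + 9 * k ^ 2 + κ * k ^ (2 * q + 4)
  obtain ⟨iw₁, bw₁⟩ := hw₁ s t hst hts
  obtain ⟨iw₂, bw₂⟩ := hw₂ s t hst hts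
  obtain ⟨in₀, bn₀⟩ := hn₀ s t hst hts
  obtain ⟨in₁, bn₁⟩ := hn₁ s t hst hts
  obtain ⟨in₂, bn₂⟩ := hn₂ s t hst hts
  simp only [mul_one, pow_one] at iw₁ bw₁ in₀ bn₀
  rw [hδ] at bw₁ bw₂ bn₀ bn₁ bn₂
  have hφb : ∫ ω, φ (W t ω - W s ω) ∂P ≤ e₁ * δ := by
    simp only [φ]
    rw [integral_add (iw₁.const_mul _) (iw₂.const_mul _), integral_const_mul, integral_const_mul]
    have := mul_le_mul_of_nonneg_left bw₂ hκ0
    rw [he₁]; linarith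
  have in₀₁ : Integrable (fun ω => ((N t ω : ℝ) - N s ω) + 9 * ((N t ω : ℝ) - N s ω) ^ 2) P :=
    in₀.add (in₁.const_mul _)
  have hψb : ∫ ω, ψ ((N t ω : ℝ) - N s ω) ∂P ≤ e₂ * δ := by
    simp only [ψ]
    rw [integral_add in₀₁ (in₂.const_mul _),
      integral_add in₀ (in₁.const_mul _), integral_const_mul, integral_const_mul]
    have := mul_le_mul_of_nonneg_left bn₂ hκ0
    rw [he₂]; linarith
  obtain ⟨hI₂, hI₂b⟩ := integrable_mul_and_integral_le (φ := φ) hindW hfm (by fun_prop) hf0 hXi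
    ((iw₁.const_mul _).add (iw₂.const_mul _)) hφb
  obtain ⟨hI₃, hI₃b⟩ := integrable_mul_and_integral_le (φ := ψ) hindN hfm (by fun_prop) hf0 hXi
    (in₀₁.add (in₂.const_mul _)) hψb
  have hδpow : (δ : ℝ) + 9 * δ ^ 2 + κ * δ ^ (2 * q + 4) ≤ e₀ * δ := by
    have h1 : (δ : ℝ) ^ 2 ≤ T * δ := by rw [sq]; gcongr
    have h2 : (δ : ℝ) ^ (2 * q + 4) ≤ T ^ (2 * q + 3) * δ := by rw [pow_succ]; gcongr
    have := mul_le_mul_of_nonneg_left h2 hκ0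
    rw [he₀]; linarith
  have hexp : (1 + 2 * D * (δ : ℝ)) ^ q ≤ Real.exp (2 * D * q * δ) := by
    have h1 : 1 + 2 * D * (δ : ℝ) ≤ Real.exp (2 * D * δ) := by
      linarith [Real.add_one_le_exp (2 * D * (δ : ℝ))]
    calc _ ≤ Real.exp (2 * D * δ) ^ q := by gcongr
      _ = _ := by rw [← Real.exp_nat_mul]; ring_nf
  set bound : Ω → ℝ := fun ω => (Real.exp (2 * D * q * δ) + c₀ * (e₀ * δ)) * f (X ω)
    + inner ℝ (H (X ω)) (W t ω - W s ω)
    + (c₀ * (f (X ω) * φ (W t ω - W s ω)) + c₀ * (f (X ω) * ψ ((N t ω : ℝ) - N s ω))) with hbound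
  have hfi : Integrable (fun ω => f (X ω)) P := hXi
  have hJ₁ : Integrable (fun ω => (Real.exp (2 * D * q * δ) + c₀ * (e₀ * δ)) * f (X ω)
      + inner ℝ (H (X ω)) (W t ω - W s ω)) P := (hfi.const_mul _).add hI₁
  have hJ₂ : Integrable (fun ω => c₀ * (f (X ω) * φ (W t ω - W s ω))
      + c₀ * (f (X ω) * ψ ((N t ω : ℝ) - N s ω))) P := (hI₂.const_mul _).add (hI₃.const_mul _)
  have hbi : Integrable bound P := hJ₁.add hJ₂
  have hle : ∀ᵐ ω ∂P, (1 + ‖X' ω‖ ^ 2) ^ q ≤ bound ω := by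
    filter_upwards [hN.counting_paths] with ω hω
    set x := X ω with hx
    set y := W t ω - W s ω with hy
    set k : ℝ := (N t ω : ℝ) - N s ω with hk
    have hk0 : 0 ≤ k := by
      have : N s ω ≤ N t ω := hω.1 hst
      rw [hk, sub_nonneg]; exact_mod_cast this
    have hcomp : compensated N lam t ω - compensated N lam s ω = k - lam * δ := by
      rw [← hδ, NNReal.coe_sub hst, hk]; simp only [compensated]; ring
    have hX'e : X' ω = z x + (δ : ℝ) • u x + g x y + k • h x := by
      rw [hstep ω, hcomp, sub_smul]; simp only [z]; abel
    have hgy : ‖g x y‖ ≤ B * √(1 + ‖x‖ ^ 2) * ‖y‖ :=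
      ((g x).le_opNorm y).trans (mul_le_mul_of_nonneg_right (hgb x) (norm_nonneg _))
    have h1 := hpt (z x) (u x) (g x y) (h x) (√(1 + ‖x‖ ^ 2)) δ ‖y‖ k (hS1 x) hδ0 (norm_nonneg _)
      hk0 (by rw [hSsq]; exact hzR x) (hub x) (hhb x) hgy
    rw [← hX'e, hSsq, ← hHin] at h1
    have h2 : (1 + ‖z x‖ ^ 2) ^ q ≤ Real.exp (2 * D * q * δ) * f x := by
      calc _ ≤ ((1 + 2 * D * δ) * (1 + ‖x‖ ^ 2)) ^ q := by gcongr; exact hzS x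
        _ = (1 + 2 * D * (δ : ℝ)) ^ q * f x := mul_pow _ _ _
        _ ≤ _ := mul_le_mul_of_nonneg_right hexp (hf0 x)
    have h3 : (δ : ℝ) + k + (δ + ‖y‖ + k) ^ 2 + (δ + ‖y‖ + k) ^ (2 * q + 4)
        ≤ e₀ * δ + φ y + ψ k := by
      have a1 := add_add_pow_le 2 hδ0 (norm_nonneg y) hk0
      have a2 := add_add_pow_le (2 * q + 4) hδ0 (norm_nonneg y) hk0
      simp only [φ, ψ]
      rw [← hκ] at a2
      have : 2 * (q + 2) = 2 * q + 4 := by ring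
      rw [this]
      linarith
    have h4 := mul_le_mul_of_nonneg_left h3 (mul_nonneg hc₀ (hf0 x))
    have h5 : c₀ * f x * (e₀ * δ + φ y + ψ k)
        = c₀ * (e₀ * δ) * f x + (c₀ * (f x * φ y) + c₀ * (f x * ψ k)) := by ring
    rw [h5] at h4
    simp only [hbound]
    rw [add_mul]
    linarith
  have hX'i : Integrable (fun ω => (1 + ‖X' ω‖ ^ 2) ^ q) P := by
    refine Integrable.mono' hbi
      (Measurable.aestronglyMeasurable (by fun_prop)) ?_
    filter_upwards [hle] with ω hω
    rwa [Real.norm_of_nonneg (by positivity)]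
  refine ⟨hX'i, (integral_mono_ae hX'i hbi hle).trans ?_⟩
  have hf0i : 0 ≤ ∫ ω, f (X ω) ∂P := integral_nonneg fun ω => hf0 _
  have hbint : ∫ ω, bound ω ∂P ≤
      (Real.exp (2 * D * q * δ) + c₀ * (e₀ + e₁ + e₂) * δ) * ∫ ω, f (X ω) ∂P := by
    simp only [hbound]
    rw [integral_add hJ₁ hJ₂,
      integral_add (hfi.const_mul _) hI₁, integral_add (hI₂.const_mul _) (hI₃.const_mul _),
      integral_const_mul, integral_const_mul, integral_const_mul, hI₁0]
    have b2 := mul_le_mul_of_nonneg_left hI₂b hc₀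
    have b3 := mul_le_mul_of_nonneg_left hI₃b hc₀
    linarith
  refine hbint.trans (mul_le_mul_of_nonneg_right ?_ hf0i)
  have hr0 : 0 ≤ c₀ * (e₀ + e₁ + e₂) * δ := by positivity
  have h1 : 1 ≤ Real.exp (2 * D * q * δ) := Real.one_le_exp (by positivity)
  have h2 := Real.add_one_le_exp (c₀ * (e₀ + e₁ + e₂) * δ)
  calc _ ≤ Real.exp (2 * D * q * δ) * (1 + c₀ * (e₀ + e₁ + e₂) * δ) := by nlinarith
    _ ≤ Real.exp (2 * D * q * δ) * Real.exp (c₀ * (e₀ + e₁ + e₂) * δ) := by gcongr; linarith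
    _ = _ := by rw [← Real.exp_add]; ring_nf

end Step

section Iterates

theorem norm_le_mul_sqrt_of_lipschitz {E G : Type*} [NormedAddCommGroup E] [NormedAddCommGroup G]
    {k : E → G} {C B : ℝ} (hC : 0 ≤ C) (hk : ∀ x y, ‖k x - k y‖ ≤ C * ‖x - y‖)
    (hB : C + ‖k 0‖ ≤ B) (x : E) : ‖k x‖ ≤ B * √(1 + ‖x‖ ^ 2) := by
  have h1 : ‖k x‖ ≤ C * ‖x‖ + ‖k 0‖ := by
    have h := hk x 0
    rw [sub_zero] at h
    have := norm_sub_norm_le (k x) (k 0)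
    linarith
  have h2 : ‖x‖ ≤ √(1 + ‖x‖ ^ 2) := Real.le_sqrt_of_sq_le (by linarith)
  have h3 : 1 ≤ √(1 + ‖x‖ ^ 2) := Real.one_le_sqrt.mpr (by have := sq_nonneg ‖x‖; linarith)
  calc ‖k x‖ ≤ C * ‖x‖ + ‖k 0‖ * 1 := by linarith
    _ ≤ C * √(1 + ‖x‖ ^ 2) + ‖k 0‖ * √(1 + ‖x‖ ^ 2) := by gcongr
    _ = (C + ‖k 0‖) * √(1 + ‖x‖ ^ 2) := by ring
    _ ≤ _ := by gcongr

theorem gridTime_le_succ (T : ℝ≥0) (M n : ℕ) : gridTime T M n ≤ gridTime T M (n + 1) := by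
  simp only [gridTime]
  gcongr
  exact Nat.le_succ n

theorem gridTime_succ_sub (T : ℝ≥0) (M n : ℕ) :
    gridTime T M (n + 1) - gridTime T M n = T / M := by
  simp only [gridTime, Nat.cast_succ, add_mul, one_mul, add_tsub_cancel_left]

variable {Ω : Type*} {mΩ : MeasurableSpace Ω} {P : Measure Ω} {F : Filtration ℝ≥0 mΩ} {d m : ℕ}

theorem measurable_semiTamedEuler
    {u v h : EuclideanSpace ℝ (Fin d) → EuclideanSpace ℝ (Fin d)}
    {g : EuclideanSpace ℝ (Fin d) → EuclideanSpace ℝ (Fin m) →L[ℝ] EuclideanSpace ℝ (Fin d)}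
    {W : ℝ≥0 → Ω → EuclideanSpace ℝ (Fin m)} (hW : ∀ t, Measurable[F t] (W t))
    {N : ℝ≥0 → Ω → ℕ} (hN : ∀ t, Measurable[F t] (N t)) (lam : ℝ≥0)
    {X₀ : Ω → EuclideanSpace ℝ (Fin d)} (hX₀ : Measurable[F 0] X₀)
    (hu : Continuous u) (hv : Continuous v) (hg : Continuous g) (hh : Continuous h)
    (T : ℝ≥0) (M n : ℕ) :
    Measurable[F (gridTime T M n)] (semiTamedEuler u v g h W N lam X₀ T M n) := by
  induction n with
  | zero => exact hX₀.mono (F.mono (zero_le)) le_rfl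
  | succ n ih =>
    have hle := F.mono (gridTime_le_succ T M n)
    have hY := ih.mono hle le_rfl
    have hW₁ := hW (gridTime T M (n + 1))
    have hW₀ := (hW (gridTime T M n)).mono hle le_rfl
    have hc : ∀ s, s ≤ gridTime T M (n + 1) →
        Measurable[F (gridTime T M (n + 1))] (compensated N lam s) := fun s hs =>
      ((measurable_from_top (f := (Nat.cast : ℕ → ℝ))).comp
        ((hN s).mono (F.mono hs) le_rfl)).sub_const _
    have hN₁ := hc _ le_rfl
    have hN₀ := hc _ (gridTime_le_succ T M n)
    have hcont : Continuous fun p : EuclideanSpace ℝ (Fin d) × EuclideanSpace ℝ (Fin m) × ℝ =>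
        p.1 + ((T : ℝ) / M) • u p.1 + ((lam : ℝ) * (T / M)) • h p.1
          + ((T : ℝ) / M / (1 + T / M * ‖v p.1‖)) • v p.1 + g p.1 p.2.1 + p.2.2 • h p.1 := by
      have h1 : Continuous fun p : EuclideanSpace ℝ (Fin d) × EuclideanSpace ℝ (Fin m) × ℝ =>
          g p.1 p.2.1 := (hg.comp continuous_fst).clm_apply (by fun_prop)
      have h2 : Continuous fun p : EuclideanSpace ℝ (Fin d) × EuclideanSpace ℝ (Fin m) × ℝ =>
          (T : ℝ) / M / (1 + T / M * ‖v p.1‖) :=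
        continuous_const.div (by fun_prop) fun p => by positivity
      fun_prop
    have hm := hcont.measurable.comp (hY.prodMk ((hW₁.sub hW₀).prodMk (hN₁.sub hN₀)))
    refine (congrArg (Measurable[F (gridTime T M (n + 1))]) (funext fun ω => ?_)).mpr hm
    rw [semiTamedEuler]
    rfl

theorem integrable_one_add_norm_sq_pow [IsFiniteMeasure P] {E : Type*} [NormedAddCommGroup E]
    {X : Ω → E} (hX : AEStronglyMeasurable X P)
    {q : ℕ} (hq : 1 ≤ q) (hmom : ∫⁻ ω, ‖X ω‖ₑ ^ ((2 * q : ℕ) : ℝ) ∂P < ⊤) :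
    Integrable (fun ω => (1 + ‖X ω‖ ^ 2) ^ q) P := by
  have hmem : MemLp X ((2 * q : ℕ) : ℝ≥0∞) P := by
    refine ⟨hX, ?_⟩
    rw [eLpNorm_lt_top_iff_lintegral_rpow_enorm_lt_top (by simp; omega) (ENNReal.natCast_ne_top _)]
    simpa using hmom
  have hi := hmem.integrable_norm_pow (by omega)
  refine Integrable.mono' (((integrable_const (1 : ℝ)).add hi).const_mul (2 ^ (q - 1)))
    ((hX.norm.pow 2).const_add 1 |>.pow q) (.of_forall fun ω => ?_)
  rw [Real.norm_of_nonneg (by positivity)]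
  have := add_pow_le zero_le_one (sq_nonneg ‖X ω‖) q
  simpa [pow_mul] using this

theorem lintegral_enorm_rpow_le {E : Type*} [NormedAddCommGroup E] {X : Ω → E} {p : ℝ} {q : ℕ}
    (hp : 0 ≤ p) (hpq : p ≤ q) (hi : Integrable (fun ω => (1 + ‖X ω‖ ^ 2) ^ q) P) :
    ∫⁻ ω, ‖X ω‖ₑ ^ p ∂P ≤ ENNReal.ofReal (∫ ω, (1 + ‖X ω‖ ^ 2) ^ q ∂P) := by
  rw [ofReal_integral_eq_lintegral_ofReal hi (.of_forall fun ω => by positivity)]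
  refine lintegral_mono fun ω => ?_
  rw [← ofReal_norm, ENNReal.ofReal_rpow_of_nonneg (norm_nonneg _) hp]
  refine ENNReal.ofReal_le_ofReal ?_
  have h1 : ‖X ω‖ ≤ 1 + ‖X ω‖ ^ 2 := by nlinarith [sq_nonneg (‖X ω‖ - 1)]
  calc ‖X ω‖ ^ p ≤ (1 + ‖X ω‖ ^ 2) ^ p := Real.rpow_le_rpow (norm_nonneg _) h1 hp
    _ ≤ (1 + ‖X ω‖ ^ 2) ^ (q : ℝ) :=
      Real.rpow_le_rpow_of_exponent_le (by linarith [sq_nonneg ‖X ω‖]) hpq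
    _ = _ := Real.rpow_natCast _ _

end Iterates

end SemiTamed

theorem theorem5p1 {Ω : Type*} {mΩ : MeasurableSpace Ω} (P : Measure Ω) [IsProbabilityMeasure P]
    (F : Filtration ℝ≥0 mΩ) {d m : ℕ}
    (u v : EuclideanSpace ℝ (Fin d) → EuclideanSpace ℝ (Fin d))
    (g : EuclideanSpace ℝ (Fin d) → EuclideanSpace ℝ (Fin m) →L[ℝ] EuclideanSpace ℝ (Fin d))
    (h : EuclideanSpace ℝ (Fin d) → EuclideanSpace ℝ (Fin d))
    (W : ℝ≥0 → Ω → EuclideanSpace ℝ (Fin m)) (hW : SemiTamed.IsBrownianMotion W F P)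
    (N : ℝ≥0 → Ω → ℕ) (lam : ℝ≥0) (hlam : 0 < lam) (hN : SemiTamed.IsPoissonProcess N lam F P)
    (X₀ : Ω → EuclideanSpace ℝ (Fin d)) (hX₀ : Measurable[F 0] X₀)
    (T : ℝ≥0) (hT : 0 < T)
    -- regularity of the coefficients
    (hf_smooth : ContDiff ℝ 1 (fun x => u x + v x)) (hg_smooth : ContDiff ℝ 1 g)
    (hh_smooth : ContDiff ℝ 1 h)
    -- all moments of the initial value are finite
    (hX₀_moments : ∀ p : ℝ, 0 < p → ∫⁻ ω, ‖X₀ ω‖ₑ ^ p ∂P < ⊤)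
    (C K c : ℝ) (hC : 0 < C) (hK : 0 < K) (hc : 0 < c)
    -- global Lipschitz condition on `g`, `h`, `u`
    (h_lip : ∀ x y, ‖g x - g y‖ ⊔ ‖h x - h y‖ ⊔ ‖u x - u y‖ ≤ C * ‖x - y‖)
    -- one-sided Lipschitz condition on the drift `u + v`
    (h_onesided : ∀ x y, inner ℝ (x - y) ((u x + v x) - (u y + v y)) ≤ C * ‖x - y‖ ^ 2)
    -- polynomial growth condition on `v`
    (h_growth : ∀ x y, ‖v x - v y‖ ≤ C * (K + ‖x‖ ^ c + ‖y‖ ^ c) * ‖x - y‖) :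
    ∀ p : ℝ, 1 ≤ p →
      (⨆ (M : ℕ) (_ : 1 ≤ M) (n : ℕ) (_ : n ≤ M),
        ∫⁻ ω, ‖SemiTamed.semiTamedEuler u v g h W N lam X₀ T M n ω‖ₑ ^ p ∂P) < ⊤ := by
  have hC0 := hC.le
  have hglip : ∀ x y, ‖g x - g y‖ ≤ C * ‖x - y‖ := fun x y =>
    (le_sup_left.trans le_sup_left).trans (h_lip x y)
  have hhlip : ∀ x y, ‖h x - h y‖ ≤ C * ‖x - y‖ := fun x y =>
    (le_sup_right.trans le_sup_left).trans (h_lip x y)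
  have hulip : ∀ x y, ‖u x - u y‖ ≤ C * ‖x - y‖ := fun x y => le_sup_right.trans (h_lip x y)
  have hu : Continuous u :=
    (LipschitzWith.of_dist_le_mul (K := C.toNNReal) fun x y => by
      rw [dist_eq_norm, dist_eq_norm, Real.coe_toNNReal _ hC0]; exact hulip x y).continuous
  have hv : Continuous v := by
    exact (hf_smooth.continuous.sub hu).congr fun x => add_sub_cancel_left (u x) (v x)
  have hvone : ∀ x y, inner ℝ (x - y) (v x - v y) ≤ 2 * C * ‖x - y‖ ^ 2 := by
    intro x y
    have h1 := h_onesided x y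
    rw [add_sub_add_comm, inner_add_right] at h1
    have h2 := (abs_le.mp (abs_real_inner_le_norm (x - y) (u x - u y))).1
    have h3 := mul_le_mul_of_nonneg_left (hulip x y) (norm_nonneg (x - y))
    linarith
  have hvbd : ∀ y, ‖y‖ = 1 → ‖v y‖ ≤ ‖v 0‖ + C * (K + 1) := by
    intro y hy
    have h1 := h_growth y 0
    rw [sub_zero, hy, norm_zero, Real.one_rpow, Real.zero_rpow hc.ne', add_zero, mul_one] at h1
    linarith [norm_sub_norm_le (v y) (v 0)]
  have hdis := SemiTamed.inner_add_norm_le_of_onesided (by positivity) (by positivity) hvone hvbd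
  set B : ℝ := C + ‖u 0‖ + ‖h 0‖ + ‖g 0‖
  have hub := SemiTamed.norm_le_mul_sqrt_of_lipschitz (B := B) hC0 hulip
    (by linarith [norm_nonneg (h 0), norm_nonneg (g 0)])
  have hhb := SemiTamed.norm_le_mul_sqrt_of_lipschitz (B := B) hC0 hhlip
    (by linarith [norm_nonneg (u 0), norm_nonneg (g 0)])
  have hgb := SemiTamed.norm_le_mul_sqrt_of_lipschitz (B := B) hC0 hglip
    (by linarith [norm_nonneg (u 0), norm_nonneg (h 0)])
  intro p hp
  set q : ℕ := ⌈p⌉₊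
  have hpq : p ≤ q := Nat.le_ceil p
  have hq : 1 ≤ q := by exact_mod_cast hp.trans hpq
  obtain ⟨κ, hκ, hstep⟩ := SemiTamed.exists_integral_step_le hW hN hv hg_smooth.continuous
    (by positivity) (by positivity) hub hhb hgb hdis T hq
  have hXi : Integrable (fun ω => (1 + ‖X₀ ω‖ ^ 2) ^ q) P :=
    SemiTamed.integrable_one_add_norm_sq_pow (hX₀.mono (F.le 0) le_rfl).aestronglyMeasurable hq
      (hX₀_moments _ (by exact_mod_cast (by omega : 0 < 2 * q)))
  have hX0 : 0 ≤ ∫ ω, (1 + ‖X₀ ω‖ ^ 2) ^ q ∂P := by positivity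
  have hmeas := fun M n => SemiTamed.measurable_semiTamedEuler hW.adapted hN.adapted lam hX₀ hu hv
    hg_smooth.continuous hh_smooth.continuous T M n
  have hiter : ∀ M : ℕ, 1 ≤ M → ∀ n : ℕ,
      Integrable (fun ω => (1 + ‖SemiTamed.semiTamedEuler u v g h W N lam X₀ T M n ω‖ ^ 2) ^ q) P ∧
      ∫ ω, (1 + ‖SemiTamed.semiTamedEuler u v g h W N lam X₀ T M n ω‖ ^ 2) ^ q ∂P
        ≤ Real.exp (n * (κ * (T / M))) * ∫ ω, (1 + ‖X₀ ω‖ ^ 2) ^ q ∂P := by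
    intro M hM n
    have hM' : (1 : ℝ≥0) ≤ M := by exact_mod_cast hM
    induction n with
    | zero => exact ⟨hXi, by simp [SemiTamed.semiTamedEuler]⟩
    | succ n ih =>
      obtain ⟨hi, hb⟩ := hstep _ _ (T / M) _ (SemiTamed.gridTime_le_succ T M n)
        (SemiTamed.gridTime_succ_sub T M n) (div_le_self (zero_le) hM') (hmeas M n) ih.1
        (SemiTamed.semiTamedEuler u v g h W N lam X₀ T M (n + 1))
        ((hmeas M (n + 1)).mono (F.le _) le_rfl)
        (fun ω => by rw [NNReal.coe_div, NNReal.coe_natCast]; rfl)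
      refine ⟨hi, hb.trans ((mul_le_mul_of_nonneg_left ih.2 (Real.exp_pos _).le).trans_eq ?_)⟩
      rw [← mul_assoc, ← Real.exp_add]
      congr 2
      push_cast
      ring
  refine lt_of_le_of_lt (b := ENNReal.ofReal
    (Real.exp (κ * T) * ∫ ω, (1 + ‖X₀ ω‖ ^ 2) ^ q ∂P)) ?_ ENNReal.ofReal_lt_top
  refine iSup_le fun M => iSup_le fun hM => iSup_le fun n => iSup_le fun hn => ?_
  obtain ⟨hi, hb⟩ := hiter M hM n
  refine (SemiTamed.lintegral_enorm_rpow_le (by linarith) hpq hi).trans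
    (ENNReal.ofReal_le_ofReal (hb.trans (mul_le_mul_of_nonneg_right ?_ hX0)))
  refine Real.exp_le_exp.mpr ?_
  have hM0 : (0 : ℝ) < M := by exact_mod_cast hM
  have hnM : (n : ℝ) ≤ M := by exact_mod_cast hn
  calc (n : ℝ) * (κ * (T / M)) ≤ M * (κ * (T / M)) := by gcongr
    _ = κ * T := by field_simp
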